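/- For an integer $n\ge 1$ let $\mathcal B^n(r)=\{x\in\mathbb R^n:\|x\|_2\le r\}$. Let $L\ge 2$ be an integer and let $P,N>0$. The squared Chebyshev radius of points $x_1,\dots,x_L\in\mathbb R^n$ is $\mathrm{rad}^2(x_1,\dots,x_L)=\min_{y\in\mathbb R^n}\max_{1\le i\le L}\|x_i-y\|_2^2$. A set $\mathcal C\subseteq\mathcal B^n(\sqrt{nP})$ is called $(P,N,L-1)$-list-decodable if $\mathrm{rad}^2_L(\mathcal C)>nN$, where $\mathrm{rad}^2_L(\mathcal C)$ denotes the infimum of $\mathrm{rad}^2(x_1,\dots,x_L)$ over all $L$-element subsets $\{x_1,\dots,x_L\}$ of $\mathcal C$ (with the value $+\infty$ if $|\mathcal C|<L$); equivalently, every closed ball of radius $\sqrt{nN}$ in $\mathbb R^n$ contains at most $L-1$ points of $\mathcal C$. The rate of $\mathcal C$ is $R(\mathcal C)=\frac1n\ln|\mathcal C|$, and the $(P,N,L-1)$-list-decoding capacity is $$C_{L-1}(P,N)=\limsup_{n\to\infty}\ \sup\bigl\{R(\mathcal C):\mathcal C\subseteq\mathcal B^n(\sqrt{nP})\text{ is }(P,N,L-1)\text{-list-decodable}\bigr\}.$$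 **Theorem.** Let $L\ge 2$ be an integer and let $N,P>0$ satisfy $\frac NP\le\frac{L-1}{L}$. Then $$C_{L-1}(P,N)\le\frac12\ln\frac{(L-1)P}{LN}.$$ -/

import Mathlib

namespace MultiplePacking

open Metric Filter

/-- The squared Chebyshev radius of a finite list of points of `ℝⁿ`: the squared radius of the
smallest ball that contains all of them. -/
noncomputable def radSq {n : ℕ} (S : Finset (EuclideanSpace ℝ (Fin n))) : EReal :=
  ⨅ y : EuclideanSpace ℝ (Fin n), ⨆ x ∈ S, ((‖x - y‖ ^ 2 : ℝ) : EReal)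

/-- The squared `(L-1)`-list-decoding radius of a code: the least squared Chebyshev radius of a
list of `L` distinct codewords (`⊤` if the code has fewer than `L` codewords). -/
noncomputable def listRadSq {n : ℕ} (L : ℕ) (C : Set (EuclideanSpace ℝ (Fin n))) : EReal :=
  ⨅ S : Finset (EuclideanSpace ℝ (Fin n)), ⨅ _ : (S : Set (EuclideanSpace ℝ (Fin n))) ⊆ C,
    ⨅ _ : S.card = L, radSq S

/-- `C` lies in the ball of radius `√(nP)` and is a `(P, N, L-1)`-list-decodable code (multiple
packing): its squared `(L-1)`-list-decoding radius exceeds `nN`. -/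
def IsListDecodable {n : ℕ} (L : ℕ) (P N : ℝ) (C : Set (EuclideanSpace ℝ (Fin n))) : Prop :=
  C ⊆ closedBall 0 (√(n * P)) ∧ ((n * N : ℝ) : EReal) < listRadSq L C

/-- The rate `(1/n) ln |C|` of a code, with value `⊤` for an infinite code (in dimension
`n ≥ 1`) and `⊥` for the empty code. -/
noncomputable def rate {n : ℕ} (C : Set (EuclideanSpace ℝ (Fin n))) : EReal :=
  ENNReal.log (C.encard : ENNReal) / (n : EReal)

/-- The `(P, N, L-1)`-list-decoding capacity `C_{L-1}(P, N)`: the limit superior, as the dimension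
tends to infinity, of the largest rate of a `(P, N, L-1)`-list-decodable code. -/
noncomputable def capacity (L : ℕ) (P N : ℝ) : EReal :=
  limsup (fun n : ℕ => ⨆ C : Set (EuclideanSpace ℝ (Fin n)), ⨆ _ : IsListDecodable L P N C, rate C)
    atTop

/-- The equivalent definition of list-decodability: every ball of radius `√(nN)` contains at most
`L-1` codewords. -/
theorem isListDecodable_iff {n : ℕ} (hn : 0 < n) {L : ℕ} (hL : 2 ≤ L) {P N : ℝ} (hN : 0 < N)
    (C : Set (EuclideanSpace ℝ (Fin n))) :
    IsListDecodable L P N C ↔ C ⊆ closedBall 0 (√(n * P)) ∧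
      ∀ y, (C ∩ closedBall y (√(n * N))).encard ≤ ((L - 1 : ℕ) : ℕ∞) := by
  have hn' : (0 : ℝ) < n := by exact_mod_cast hn
  have hnN : (0 : ℝ) < n * N := by positivity
  unfold IsListDecodable
  refine and_congr_right fun hC => ⟨fun h y => ?_, fun h => ?_⟩
  · by_contra hlt
    push Not at hlt
    have hle : (L : ℕ∞) ≤ (C ∩ closedBall y (√(n * N))).encard := by
      have := Order.add_one_le_of_lt hlt
      refine le_trans ?_ this
      norm_cast
      omega
    obtain ⟨t, ht, htc⟩ := Set.exists_subset_encard_eq hle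
    have htf : t.Finite := Set.finite_of_encard_eq_coe htc
    refine absurd h (not_lt.mpr ?_)
    refine (iInf_le_of_le htf.toFinset <| iInf_le_of_le ?_ <| iInf_le_of_le ?_ <|
      iInf_le_of_le y <| iSup₂_le ?_)
    · intro x hx
      exact (ht (htf.mem_toFinset.mp hx)).1
    · rw [htf.encard_eq_coe_toFinset_card] at htc
      exact_mod_cast htc
    · intro x hx
      have hx' := (ht (htf.mem_toFinset.mp hx)).2
      rw [mem_closedBall, dist_eq_norm] at hx'
      rw [EReal.coe_le_coe_iff, ← Real.sq_sqrt hnN.le]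
      gcongr
  · have hfin : C.Finite := by
      have hK := isCompact_closedBall (0 : EuclideanSpace ℝ (Fin n)) (√(n * P))
      obtain ⟨t, -, htf, ht⟩ := hK.finite_cover_balls (Real.sqrt_pos.mpr hnN)
      refine (htf.biUnion (t := fun y => C ∩ closedBall y (√(n * N))) fun y _ => ?_).subset ?_
      · exact Set.finite_of_encard_le_coe (h y)
      · intro x hx
        obtain ⟨y, hy, hxy⟩ := Set.mem_iUnion₂.mp (ht (hC hx))
        exact Set.mem_iUnion₂.mpr ⟨y, hy, hx, ball_subset_closedBall hxy⟩
    have key : ∀ S : Finset (EuclideanSpace ℝ (Fin n)), (S : Set _) ⊆ C → S.card = L →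
        ((n * N : ℝ) : EReal) < radSq S := by
      intro S hS hSL
      by_contra hle
      push Not at hle
      have hSne : S.Nonempty := Finset.card_pos.mp (by omega)
      obtain ⟨x₀, hx₀⟩ := hSne
      let K : ℕ → Set (EuclideanSpace ℝ (Fin n)) := fun k =>
        ⋂ x ∈ S, closedBall x (√(n * N + 1 / ((k : ℝ) + 1)))
      have hKc : ∀ k, IsClosed (K k) := fun k =>
        isClosed_biInter fun x _ => isClosed_closedBall
      have hKn : ∀ k, (K k).Nonempty := by
        intro k
        have hk : (0 : ℝ) < 1 / ((k : ℝ) + 1) := by positivity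
        have hlt : radSq S < ((n * N + 1 / ((k : ℝ) + 1) : ℝ) : EReal) :=
          lt_of_le_of_lt hle (by rw [EReal.coe_lt_coe_iff]; linarith)
        obtain ⟨y, hy⟩ := iInf_lt_iff.mp hlt
        refine ⟨y, Set.mem_iInter₂.mpr fun x hx => ?_⟩
        have h1 := (le_iSup₂ (f := fun x (_ : x ∈ S) => ((‖x - y‖ ^ 2 : ℝ) : EReal)) x hx).trans hy.le
        rw [EReal.coe_le_coe_iff] at h1
        rw [mem_closedBall, dist_comm, dist_eq_norm]
        exact Real.le_sqrt_of_sq_le h1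
      have hKm : ∀ k, K (k + 1) ⊆ K k := by
        intro k
        refine Set.iInter₂_mono fun x _ => closedBall_subset_closedBall (Real.sqrt_le_sqrt ?_)
        push_cast
        gcongr
        linarith
      have hK0 : IsCompact (K 0) :=
        (isCompact_closedBall x₀ _).of_isClosed_subset (hKc 0) (Set.biInter_subset_of_mem hx₀)
      obtain ⟨y, hy⟩ := IsCompact.nonempty_iInter_of_sequence_nonempty_isCompact_isClosed
        K hKm hKn hK0 hKc
      have hyS : ∀ x ∈ S, x ∈ closedBall y (√(n * N)) := by
        intro x hx
        rw [mem_closedBall, dist_eq_norm]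
        refine Real.le_sqrt_of_sq_le (le_of_forall_pos_le_add fun ε hε => ?_)
        obtain ⟨k, hk⟩ := exists_nat_one_div_lt hε
        have h1 := Set.mem_iInter₂.mp (Set.mem_iInter.mp hy k) x hx
        have hp : (0 : ℝ) < 1 / ((k : ℝ) + 1) := by positivity
        rw [mem_closedBall, dist_comm, dist_eq_norm,
          Real.le_sqrt (norm_nonneg _) (by linarith)] at h1
        linarith
      have h2 : (S : Set _).encard ≤ (C ∩ closedBall y (√(n * N))).encard :=
        Set.encard_le_encard fun x hx => ⟨hS hx, hyS x hx⟩
      have h3 := h2.trans (h y)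
      rw [Set.encard_coe_eq_coe_finsetCard, hSL] at h3
      have : L ≤ L - 1 := by exact_mod_cast h3
      omega
    by_contra hle
    push Not at hle
    have hT : {S : Finset (EuclideanSpace ℝ (Fin n)) | (S : Set _) ⊆ C ∧ S.card = L}.Finite :=
      (hfin.finite_subsets.preimage Finset.coe_injective.injOn).subset fun S hS => hS.1
    rcases Set.eq_empty_or_nonempty
      {S : Finset (EuclideanSpace ℝ (Fin n)) | (S : Set _) ⊆ C ∧ S.card = L} with he | hne
    · have : listRadSq L C = ⊤ := by
        unfold listRadSq
        simp only [iInf_eq_top]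
        intro S h1 h2
        exact absurd (show S ∈ {S : Finset (EuclideanSpace ℝ (Fin n)) |
          (S : Set _) ⊆ C ∧ S.card = L} from ⟨h1, h2⟩) (by simp [he])
      rw [this] at hle
      exact absurd hle (not_le.mpr (EReal.coe_lt_top _))
    · obtain ⟨S, hS, hmin⟩ := Set.exists_min_image _ radSq hT hne
      refine absurd (lt_of_lt_of_le (key S hS.1 hS.2) ?_) (not_lt.mpr hle)
      exact le_iInf fun S' => le_iInf fun h1 => le_iInf fun h2 => hmin S' ⟨h1, h2⟩

end MultiplePacking

namespace MultiplePacking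

open Metric Filter MeasureTheory

/-! The argument is of Elias–Bassalygo type. Take Q slightly below LN/(L-1). A ball of radius √(nQ)
holds at most K codewords, with K independent of n (`exists_card_le_of_subset_closedBall`). Indeed,
Ramsey's theorem extracts from many such points a large nearly equidistant set. Its common squared
distance is at most about 2nQ, so any L of its points lie within squared distance about (L-1)/L · nQ
< nN of their centroid.

Now average over centres y in the ball of radius √(n(P-Q)) about 0. For each codeword x, the lens of
those y within √(nQ) of x has, up to a constant factor, at least the volume of a ball of radius
nearly √(nQ(P-Q)/P) (`measure_closedBall_le_mul_lens`). Counting pairs (`card_mul_pow_le`) bounds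
the code size by a constant times roughly (P/Q)^(n/2). -/

/-! ### Ramsey's theorem -/

/-- Off-diagonal Ramsey theorem for edge colourings with finitely many colours. -/
theorem exists_ramsey_aux {κ : Type} [Fintype κ] [DecidableEq κ] [Nonempty κ] (s : ℕ) :
    ∀ f : κ → ℕ, ∑ k, f k = s → ∃ M : ℕ, ∀ (α : Type) (χ : α → α → κ),
      (∀ x y, χ x y = χ y x) → ∀ C : Finset α, M ≤ C.card →
        ∃ k, ∃ S ⊆ C, S.card = f k ∧ ∀ x ∈ S, ∀ y ∈ S, x ≠ y → χ x y = k := by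
  classical
  induction s with
  | zero =>
    intro f hf
    refine ⟨0, fun α χ _ C _ => ⟨Classical.arbitrary κ, ∅, by simp, ?_, by simp⟩⟩
    have := (Finset.sum_eq_zero_iff.mp hf) (Classical.arbitrary κ) (Finset.mem_univ _)
    simp [this]
  | succ s ih =>
    intro f hf
    by_cases h0 : ∃ k, f k = 0
    · obtain ⟨k, hk⟩ := h0
      exact ⟨0, fun α χ _ C _ => ⟨k, ∅, by simp, by simp [hk], by simp⟩⟩
    push Not at h0
    have hstep : ∀ k, ∑ j, Function.update f k (f k - 1) j = s := by
      intro k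
      have h1 := Finset.add_sum_erase Finset.univ f (Finset.mem_univ k)
      rw [Finset.sum_update_of_mem (Finset.mem_univ k), ← Finset.erase_eq]
      have := h0 k
      omega
    choose M hM using fun k => ih _ (hstep k)
    -- Remove a vertex `x`; by pigeonhole some colour `k` at `x` reaches at least `M k` points.
    -- Among them, a set of colour `k` need only have `f k - 1` points, since `x` extends it.
    refine ⟨1 + ∑ k, M k, fun α χ hχ C hC => ?_⟩
    obtain ⟨x, hx⟩ : C.Nonempty := Finset.card_pos.mp (by omega)
    have hcard : ∑ k, M k ≤ ∑ k, ((C.erase x).filter fun y => χ x y = k).card := by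
      rw [← Finset.card_eq_sum_card_fiberwise (fun _ _ => Finset.mem_coe.mpr (Finset.mem_univ _)),
        Finset.card_erase_of_mem hx]
      omega
    obtain ⟨k, -, hk⟩ := Finset.exists_le_of_sum_le Finset.univ_nonempty hcard
    obtain ⟨j, S, hS, hSc, hSχ⟩ := hM k α χ hχ _ hk
    have hSC : ∀ y ∈ S, y ≠ x ∧ y ∈ C ∧ χ x y = k := fun y hy => by
      simpa [and_assoc] using hS hy
    by_cases hj : j = k
    · subst hj
      refine ⟨j, insert x S, ?_, ?_, ?_⟩
      · intro y hy
        rcases Finset.mem_insert.mp hy with rfl | hy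
        exacts [hx, (hSC y hy).2.1]
      · rw [Finset.card_insert_of_notMem fun h => (hSC x h).1 rfl, hSc]
        have := h0 j
        simp
        omega
      · intro a ha b hb hab
        rcases Finset.mem_insert.mp ha with rfl | haS <;>
          rcases Finset.mem_insert.mp hb with rfl | hbS
        · exact absurd rfl hab
        · exact (hSC b hbS).2.2
        · rw [hχ]; exact (hSC a haS).2.2
        · exact hSχ a haS b hbS hab
    · exact ⟨j, S, fun y hy => (hSC y hy).2.1, by simpa [hj] using hSc, hSχ⟩

/-- Ramsey's theorem for edge colourings with finitely many colours. -/
theorem exists_ramsey (κ : Type) [Fintype κ] [Nonempty κ] (t : ℕ) :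
    ∃ M : ℕ, ∀ (α : Type) (χ : α → α → κ), (∀ x y, χ x y = χ y x) →
      ∀ C : Finset α, M ≤ C.card →
        ∃ k, ∃ S ⊆ C, S.card = t ∧ ∀ x ∈ S, ∀ y ∈ S, x ≠ y → χ x y = k := by
  classical
  exact exists_ramsey_aux _ (fun _ => t) rfl

/-! ### Nearly equidistant points and the Plotkin bound -/

/-- A lower bound for the sum of squared distances of pairwise distant points. -/
theorem card_mul_le_sum_sum_norm_sub_sq {E : Type*} [NormedAddCommGroup E] {S : Finset E}
    {l : ℝ} (hl : ∀ x ∈ S, ∀ y ∈ S, x ≠ y → l ≤ ‖x - y‖ ^ 2) :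
    (S.card : ℝ) * ((S.card - 1) * l) ≤ ∑ x ∈ S, ∑ y ∈ S, ‖x - y‖ ^ 2 := by
  classical
  rw [← nsmul_eq_mul]
  refine Finset.card_nsmul_le_sum _ _ _ fun x hx => ?_
  rw [← Finset.add_sum_erase S _ hx, sub_self, norm_zero]
  have h := Finset.card_nsmul_le_sum (S.erase x) (fun y => ‖x - y‖ ^ 2) l fun y hy =>
    hl x hx y (Finset.mem_of_mem_erase hy) (Finset.ne_of_mem_erase hy).symm
  rw [nsmul_eq_mul, Finset.card_erase_of_mem hx, Nat.cast_pred (Finset.card_pos.mpr ⟨x, hx⟩)] at h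
  simpa using h

section Plotkin

variable {E : Type*} [NormedAddCommGroup E] [InnerProductSpace ℝ E]

theorem sum_sum_norm_sub_sq (S : Finset E) :
    ∑ x ∈ S, ∑ y ∈ S, ‖x - y‖ ^ 2 = 2 * S.card * ∑ x ∈ S, ‖x‖ ^ 2 - 2 * ‖∑ x ∈ S, x‖ ^ 2 := by
  rw [← real_inner_self_eq_norm_sq (∑ x ∈ S, x), sum_inner]
  simp only [inner_sum, norm_sub_sq_real, Finset.sum_add_distrib, Finset.sum_sub_distrib,
    Finset.sum_const, nsmul_eq_mul, ← Finset.mul_sum]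
  ring

/-- Points in a ball of radius `r` cannot be pairwise much further apart than `√2 r`. -/
theorem card_sub_one_mul_le_of_subset_closedBall {S : Finset E} (hS : S.Nonempty) {c : E}
    {a l : ℝ} (ha : ∀ x ∈ S, ‖x - c‖ ^ 2 ≤ a)
    (hl : ∀ x ∈ S, ∀ y ∈ S, x ≠ y → l ≤ ‖x - y‖ ^ 2) :
    ((S.card : ℝ) - 1) * l ≤ 2 * S.card * a := by
  classical
  have hpos : (0 : ℝ) < S.card := by exact_mod_cast hS.card_pos
  have h1 : ∑ x ∈ S, ∑ y ∈ S, ‖x - y‖ ^ 2 ≤ 2 * S.card * (S.card * a) := by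
    -- Translate `c` to the origin; the term -2‖∑(x - c)‖² is then dropped.
    have h := sum_sum_norm_sub_sq (S.image fun x => x - c)
    have hinj : Set.InjOn (fun x : E => x - c) S := fun _ _ _ _ h => sub_left_injective h
    simp only [Finset.sum_image hinj, Finset.card_image_of_injOn hinj, sub_sub_sub_cancel_right]
      at h
    have h2 : ∑ x ∈ S, ‖x - c‖ ^ 2 ≤ S.card * a := by
      simpa using Finset.sum_le_sum ha
    have h3 := mul_le_mul_of_nonneg_left h2 (by positivity : (0 : ℝ) ≤ 2 * S.card)
    nlinarith [sq_nonneg ‖∑ x ∈ S, (x - c)‖]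
  have h2 : (S.card : ℝ) * ((S.card - 1) * l) ≤ ∑ x ∈ S, ∑ y ∈ S, ‖x - y‖ ^ 2 := 
    card_mul_le_sum_sum_norm_sub_sq hl
  have h3 := h2.trans h1
  have : (S.card : ℝ) * ((S.card - 1) * l) ≤ S.card * (2 * S.card * a) := by linarith
  exact le_of_mul_le_mul_left this hpos

/-- The centroid of a set of almost equidistant points is almost equidistant from them. -/
theorem norm_sub_centroid_sq_le {S : Finset E} {l u : ℝ}
    (hl : ∀ x ∈ S, ∀ y ∈ S, x ≠ y → l ≤ ‖x - y‖ ^ 2)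
    (hu : ∀ x ∈ S, ∀ y ∈ S, x ≠ y → ‖x - y‖ ^ 2 ≤ u) {x : E} (hx : x ∈ S) :
    ‖x - (S.card : ℝ)⁻¹ • ∑ y ∈ S, y‖ ^ 2 ≤ ((S.card : ℝ) - 1) / S.card * (u - l / 2) := by
  classical
  have hne : S.Nonempty := ⟨x, hx⟩
  have hpos : (0 : ℝ) < S.card := by exact_mod_cast hne.card_pos
  -- The squared distance from `x` to the centroid is the mean of ‖x - y‖² over `S` minus half the
  -- mean over all ordered pairs. The first mean is bounded by `u`, the second by `l`, diagonal
  -- terms being zero.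
  have hU : ∑ y ∈ S, ‖x - y‖ ^ 2 ≤ (S.card - 1) * u := by
    rw [← Finset.add_sum_erase S _ hx, sub_self, norm_zero]
    have h4 := Finset.sum_le_card_nsmul (S.erase x) (fun y => ‖x - y‖ ^ 2) u fun y hy =>
      hu x hx y (Finset.mem_of_mem_erase hy) (Finset.ne_of_mem_erase hy).symm
    rw [nsmul_eq_mul, Finset.card_erase_of_mem hx, Nat.cast_pred hne.card_pos] at h4
    simpa using h4
  have hD : (S.card : ℝ) * ((S.card - 1) * l) ≤ ∑ x ∈ S, ∑ y ∈ S, ‖x - y‖ ^ 2 := 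
    card_mul_le_sum_sum_norm_sub_sq hl
  rw [sum_sum_norm_sub_sq] at hD
  have hE : ∑ y ∈ S, ‖x - y‖ ^ 2 =
      S.card * ‖x‖ ^ 2 - 2 * inner ℝ x (∑ y ∈ S, y) + ∑ y ∈ S, ‖y‖ ^ 2 := by
    simp only [norm_sub_sq_real, Finset.sum_add_distrib, Finset.sum_sub_distrib, Finset.sum_const,
      nsmul_eq_mul, ← Finset.mul_sum, inner_sum]
  rw [hE] at hU
  rw [norm_sub_sq_real, inner_smul_right, norm_smul, mul_pow, norm_inv, Real.norm_natCast,
    div_mul_eq_mul_div, le_div_iff₀ hpos]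
  have e : (‖x‖ ^ 2 - 2 * ((S.card : ℝ)⁻¹ * inner ℝ x (∑ y ∈ S, y)) +
      (S.card : ℝ)⁻¹ ^ 2 * ‖∑ y ∈ S, y‖ ^ 2) * S.card = S.card * ‖x‖ ^ 2
      - 2 * inner ℝ x (∑ y ∈ S, y) + ‖∑ y ∈ S, y‖ ^ 2 / S.card := by
    field_simp
  rw [e]
  have hD' : ((S.card : ℝ) - 1) * l ≤ 2 * ∑ x ∈ S, ‖x‖ ^ 2 - 2 * (‖∑ x ∈ S, x‖ ^ 2 / S.card) := by
    refine le_of_mul_le_mul_left (hD.trans (le_of_eq ?_)) hpos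
    field_simp
  linarith

end Plotkin

/-- Plotkin bound: if `Q < LN/(L-1)`, a ball of radius `√(nQ)` contains boundedly many points of a
code all of whose `L`-lists have squared Chebyshev radius exceeding `nN`. -/
theorem exists_card_le_of_subset_closedBall {L : ℕ} (hL : 2 ≤ L) {N Q : ℝ} (hQ : 0 < Q)
    (hQN : ((L : ℝ) - 1) / L * Q < N) :
    ∃ K : ℕ, ∀ n : ℕ, 0 < n → ∀ (F : Finset (EuclideanSpace ℝ (Fin n)))
      (c : EuclideanSpace ℝ (Fin n)), (∀ x ∈ F, ‖x - c‖ ^ 2 ≤ n * Q) →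
      (∀ S ⊆ F, S.card = L → ∀ y, ∃ x ∈ S, n * N < ‖x - y‖ ^ 2) → F.card ≤ K := by
  classical
  have hL' : (2 : ℝ) ≤ L := by exact_mod_cast hL
  set g : ℝ := ((L : ℝ) - 1) / L with hg
  have hg0 : 0 < g := div_pos (by linarith) (by linarith)
  obtain ⟨ε, hε, hεN⟩ : ∃ ε : ℝ, 0 < ε ∧ g * (Q + 2 * ε) ≤ N := by
    refine ⟨(N - g * Q) / (2 * g), div_pos (by linarith) (by linarith), le_of_eq ?_⟩
    field_simp
    ring
  -- This `t` gives t·Q ≤ (t-1)(Q+ε), so `t` equidistant points have squared distance at most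
  -- 2n(Q+ε).
  obtain ⟨t, ht⟩ := exists_nat_gt (Q / ε + 1 + L)
  have hQε : 0 < Q / ε := by positivity
  have htL : L ≤ t := by
    have : (L : ℝ) ≤ t := by linarith
    exact_mod_cast this
  have ht1 : Q ≤ ((t : ℝ) - 1) * ε := by
    rw [← div_le_iff₀ hε]; linarith
  -- Colours are squared distances, at most 4nQ, in steps of nε, so their number is independent of
  -- n. The reduction modulo this number in `Fin.ofNat` never acts on points of `F`.
  obtain ⟨M, hM⟩ := exists_ramsey (Fin (⌊4 * Q / ε⌋₊ + 1)) t
  refine ⟨M, fun n hn F c hF hS => ?_⟩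
  by_contra! hlt
  have hn' : (0 : ℝ) < n := by exact_mod_cast hn
  have hnε : 0 < n * ε := by positivity
  have hdist : ∀ x ∈ F, ∀ y ∈ F, ‖x - y‖ ^ 2 ≤ 4 * (n * Q) := by
    intro x hx y hy
    have h1 := parallelogram_law_with_norm ℝ (x - c) (y - c)
    rw [sub_sub_sub_cancel_right] at h1
    nlinarith [hF x hx, hF y hy, sq_nonneg ‖x - c + (y - c)‖]
  obtain ⟨k, S, hSF, hSt, hSk⟩ := hM (EuclideanSpace ℝ (Fin n))
    (fun x y => Fin.ofNat _ ⌊‖x - y‖ ^ 2 / (n * ε)⌋₊) (fun x y => by simp only [norm_sub_rev])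
    F hlt.le
  have hcol : ∀ x ∈ S, ∀ y ∈ S, x ≠ y →
      k * (n * ε) ≤ ‖x - y‖ ^ 2 ∧ ‖x - y‖ ^ 2 ≤ (k + 1) * (n * ε) := by
    intro x hx y hy hxy
    have h1 := congrArg Fin.val (hSk x hx y hy hxy)
    have h2 : ⌊‖x - y‖ ^ 2 / (n * ε)⌋₊ ≤ ⌊4 * Q / ε⌋₊ := by
      refine Nat.floor_mono ?_
      rw [div_le_div_iff₀ hnε hε]
      nlinarith [hdist x (hSF hx) y (hSF hy)]
    rw [Fin.val_ofNat, Nat.mod_eq_of_lt (by omega)] at h1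
    rw [← h1, ← le_div_iff₀ hnε, ← div_le_iff₀ hnε]
    exact ⟨Nat.floor_le (by positivity), (Nat.lt_floor_add_one _).le⟩
  have hSne : S.Nonempty := Finset.card_pos.mp (by omega)
  have h1 := card_sub_one_mul_le_of_subset_closedBall hSne (fun x hx => hF x (hSF hx))
    fun x hx y hy hxy => (hcol x hx y hy hxy).1
  rw [hSt] at h1
  obtain ⟨T, hTS, hT⟩ := Finset.exists_subset_card_eq (htL.trans hSt.ge)
  obtain ⟨x, hx, hxN⟩ := hS T (hTS.trans hSF) hT ((T.card : ℝ)⁻¹ • ∑ y ∈ T, y)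
  have h2 := norm_sub_centroid_sq_le (fun x hx y hy hxy => (hcol x (hTS hx) y (hTS hy) hxy).1)
    (fun x hx y hy hxy => (hcol x (hTS hx) y (hTS hy) hxy).2) hx
  rw [hT, ← hg] at h2
  rw [hT] at hxN
  have ht0 : (0 : ℝ) < t - 1 := by linarith
  have h3 : (k : ℝ) * (n * ε) ≤ 2 * (n * (Q + ε)) := by
    refine le_of_mul_le_mul_left (h1.trans ?_) ht0
    nlinarith
  have h4 : g * (((k : ℝ) + 1) * (n * ε) - k * (n * ε) / 2) ≤ g * (n * (Q + 2 * ε)) := by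
    refine mul_le_mul_of_nonneg_left ?_ hg0.le
    nlinarith
  nlinarith

/-! ### Volumes of slabs and lenses -/

section Volume

variable {E : Type*} [NormedAddCommGroup E] [InnerProductSpace ℝ E] [MeasurableSpace E]
  [BorelSpace E]

/-- Among the parallel slabs of a given width, the central one has the largest intersection with a
ball. -/
theorem measure_closedBall_le_mul_slab (μ : Measure E) [μ.IsAddHaarMeasure] (x : E) {ρ τ : ℝ}
    (hτ : 0 < τ) {m : ℕ} (hm : ‖x‖ * ρ ≤ m * τ) :
    μ (closedBall 0 ρ) ≤ (2 * m + 1 : ℕ) * μ {w | ‖w‖ ≤ ρ ∧ |inner ℝ x w| ≤ τ} := by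
  rcases eq_or_ne x 0 with rfl | hx
  · have : {w : E | ‖w‖ ≤ ρ ∧ |inner ℝ (0 : E) w| ≤ τ} = closedBall 0 ρ := by
      ext w; simp [hτ.le]
    rw [this]
    exact le_mul_of_one_le_left zero_le (by exact_mod_cast Nat.le_add_left 1 (2 * m))
  have hx0 : 0 < ‖x‖ ^ 2 := by positivity
  set A : Set E := {w | ‖w‖ ≤ ρ ∧ |inner ℝ x w| ≤ τ}
  let v : ℤ → E := fun k => (k * τ / ‖x‖ ^ 2) • x
  -- Rounding ⟨x, w⟩/τ to `k` and subtracting `v k` puts `w` in the central slab. Its norm does not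
  -- grow, because |a - kτ| ≤ |a|.
  have hcov : closedBall (0 : E) ρ ⊆ ⋃ k ∈ Finset.Icc (-(m : ℤ)) m, (fun w => w - v k) ⁻¹' A := by
    intro w hw
    rw [mem_closedBall_zero_iff] at hw
    set a : ℝ := inner ℝ x w with ha
    set k : ℤ := round (a / τ) with hk
    have hav : inner ℝ x (v k) = k * τ := by
      simp only [v, inner_smul_right, real_inner_self_eq_norm_sq]
      field_simp
    have hround : |a - k * τ| ≤ τ / 2 := by
      have h := abs_sub_round (a / τ)
      rw [← hk] at h
      have e : a - k * τ = (a / τ - k) * τ := by field_simp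
      rw [e, abs_mul, abs_of_pos hτ]
      nlinarith
    have habs : |a| ≤ m * τ := (abs_real_inner_le_norm x w).trans
      ((mul_le_mul_of_nonneg_left hw (norm_nonneg _)).trans hm)
    have hkτ : |(k : ℝ)| * τ ≤ |a| + |a - k * τ| := by
      have := abs_sub_abs_le_abs_sub (k * τ) a
      rw [abs_sub_comm, abs_mul, abs_of_pos hτ] at this
      linarith
    have hle : |a - k * τ| ≤ |a| := by
      rcases eq_or_ne k 0 with h0 | h0
      · simp [h0]
      · have h1 : (1 : ℝ) ≤ |(k : ℝ)| := by exact_mod_cast Int.one_le_abs h0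
        nlinarith [hkτ]
    have hkm : |k| ≤ m := by
      have h3 : |(k : ℝ)| < m + 1 := by
        refine lt_of_mul_lt_mul_right ?_ hτ.le
        nlinarith
      have h4 : |k| < m + 1 := by exact_mod_cast h3
      omega
    refine Set.mem_iUnion₂.mpr ⟨k, Finset.mem_Icc.mpr (abs_le.mp hkm), ?_, ?_⟩
    · refine le_trans ?_ hw
      refine le_of_sq_le_sq ?_ (norm_nonneg _)
      have h1 : ‖w - v k‖ ^ 2 = ‖w‖ ^ 2 + ((a - k * τ) ^ 2 - a ^ 2) / ‖x‖ ^ 2 := by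
        rw [norm_sub_sq_real]
        simp only [v, inner_smul_right, norm_smul, Real.norm_eq_abs, mul_pow, sq_abs]
        rw [real_inner_comm, ← ha]
        field_simp
        ring
      rw [h1]
      have h2 := sq_le_sq.mpr hle
      have h3 : ((a - k * τ) ^ 2 - a ^ 2) / ‖x‖ ^ 2 ≤ 0 :=
        div_nonpos_of_nonpos_of_nonneg (by linarith) hx0.le
      linarith
    · rw [inner_sub_right, hav, ← ha]
      linarith
  refine (measure_mono hcov).trans ((measure_biUnion_finset_le _ _).trans (le_of_eq ?_))
  simp only [sub_eq_add_neg, measure_preimage_add_right, Finset.sum_const, Int.card_Icc,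
    nsmul_eq_mul]
  congr 2
  omega

/-- Lower bound for the volume of the lens cut out by two orthogonal spheres. -/
theorem measure_closedBall_le_mul_lens (μ : Measure E) [μ.IsAddHaarMeasure] {x : E}
    {R r s ρ τ : ℝ} (hR : 0 < R) (hr : 0 ≤ r) (hs : 0 ≤ s) (hrs : s ^ 2 + r ^ 2 = R ^ 2)
    (hx : ‖x‖ ≤ R) (hρ : 0 ≤ ρ) (hτ : 0 < τ) (hρτ : ρ ^ 2 + 2 * τ ≤ s ^ 2 * r ^ 2 / R ^ 2)
    {m : ℕ} (hm : R * ρ ≤ m * τ) :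
    μ (closedBall 0 ρ) ≤ (2 * m + 1 : ℕ) * μ (closedBall x r ∩ closedBall 0 s) := by
  refine (measure_closedBall_le_mul_slab μ x hτ
    ((mul_le_mul_of_nonneg_right hx hρ).trans hm)).trans (mul_le_mul' le_rfl ?_)
  -- When ‖x‖ = R, the orthogonal spheres meet in the hyperplane through `p • x` normal to `x`. The
  -- central slab is translated there; `2 * τ` absorbs the cross term, and p²+pq = p, q²+pq = q give
  -- the radii `s` and `r`.
  set p : ℝ := s ^ 2 / R ^ 2
  set q : ℝ := r ^ 2 / R ^ 2
  have hR2 : 0 < R ^ 2 := by positivity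
  have hp : 0 ≤ p := by positivity
  have hq : 0 ≤ q := by positivity
  have hpq : p + q = 1 := by
    simp only [p, q]; rw [← add_div, hrs, div_self hR2.ne']
  have hs2 : s ^ 2 = p * R ^ 2 := by simp only [p]; field_simp
  have hr2 : r ^ 2 = q * R ^ 2 := by simp only [q]; field_simp
  have hpqR : s ^ 2 * r ^ 2 / R ^ 2 = p * q * R ^ 2 := by simp only [p, q]; field_simp
  rw [hpqR] at hρτ
  have hx2 : ‖x‖ ^ 2 ≤ R ^ 2 := by gcongr
  have key : ∀ c : ℝ, |c| ≤ 1 → ∀ w : E, ‖w‖ ≤ ρ → |inner ℝ x w| ≤ τ →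
      ‖c • x + w‖ ^ 2 ≤ c ^ 2 * R ^ 2 + p * q * R ^ 2 := by
    intro c hc w hw hwτ
    rw [norm_add_sq_real, norm_smul, inner_smul_left, mul_pow, Real.norm_eq_abs, sq_abs]
    simp only [conj_trivial]
    have h1 : c * inner ℝ x w ≤ τ := by
      refine (le_abs_self _).trans ?_
      rw [abs_mul]
      nlinarith [abs_nonneg c, abs_nonneg (inner ℝ x w)]
    have h2 : ‖w‖ ^ 2 ≤ ρ ^ 2 := by gcongr
    have h3 := mul_le_mul_of_nonneg_left hx2 (sq_nonneg c)
    linarith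
  rw [← measure_preimage_add_right μ (-(p • x)) {w | ‖w‖ ≤ ρ ∧ |inner ℝ x w| ≤ τ}]
  refine measure_mono ?_
  rintro z ⟨hz1, hz2⟩
  constructor
  · rw [mem_closedBall, dist_eq_norm]
    refine le_of_sq_le_sq ?_ hr
    have h := key (-q) (by rw [abs_neg, abs_of_nonneg hq]; linarith) _ hz1 hz2
    have e : -q • x + (z + -(p • x)) = z - x := by
      rw [show q = 1 - p by linarith]; module
    rw [e] at h
    refine h.trans (le_of_eq ?_)
    rw [hr2, show p = 1 - q by linarith]; ring
  · rw [mem_closedBall_zero_iff]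
    refine le_of_sq_le_sq ?_ hs
    have h := key p (by rw [abs_of_nonneg hp]; linarith) _ hz1 hz2
    rw [add_neg_cancel_comm_assoc] at h
    refine h.trans (le_of_eq ?_)
    rw [hs2, show q = 1 - p by linarith]; ring

end Volume

/-! ### Averaging over centres -/

/-- Double counting: the total mass of the pieces of `B` cut out by balls around the points of a
finite set. -/
theorem sum_measure_closedBall_inter_le {E : Type*} [NormedAddCommGroup E] [MeasurableSpace E]
    [BorelSpace E] (μ : Measure E) (F : Finset E) {r : ℝ} {K : ℕ} {B : Set E}
    (hK : ∀ y, ∀ S ⊆ F, (∀ x ∈ S, ‖x - y‖ ≤ r) → S.card ≤ K) :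
    ∑ x ∈ F, μ (closedBall x r ∩ B) ≤ K * μ B := by
  classical
  have h1 : ∀ x ∈ F, μ (closedBall x r ∩ B) =
      ∫⁻ y in B, (closedBall x r).indicator (fun _ => (1 : ENNReal)) y ∂μ := by
    intro x _
    rw [lintegral_indicator isClosed_closedBall.measurableSet, lintegral_one,
      Measure.restrict_apply_univ, Measure.restrict_apply isClosed_closedBall.measurableSet]
  rw [Finset.sum_congr rfl h1, ← lintegral_finsetSum _ fun x _ =>
    measurable_const.indicator isClosed_closedBall.measurableSet, ← setLIntegral_const]
  refine lintegral_mono fun y => ?_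
  have h2 : ∑ x ∈ F, (closedBall x r).indicator (fun _ => (1 : ENNReal)) y =
      ((F.filter fun x => y ∈ closedBall x r).card : ENNReal) := by
    simp only [Set.indicator_apply]
    rw [Finset.sum_boole]
  rw [h2]
  have h3 := hK y (F.filter fun x => y ∈ closedBall x r) (Finset.filter_subset _ _) fun x hx => by
    have := (Finset.mem_filter.mp hx).2
    rwa [mem_closedBall', dist_eq_norm] at this
  exact Nat.cast_le.mpr h3

/-- Elias–Bassalygo type averaging. -/
theorem card_mul_pow_le {n : ℕ} (F : Finset (EuclideanSpace ℝ (Fin n))) {R r s ρ τ : ℝ}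
    (hR : 0 < R) (hr : 0 ≤ r) (hs : 0 ≤ s) (hrs : s ^ 2 + r ^ 2 = R ^ 2)
    (hF : ∀ x ∈ F, ‖x‖ ≤ R) (hρ : 0 ≤ ρ) (hτ : 0 < τ)
    (hρτ : ρ ^ 2 + 2 * τ ≤ s ^ 2 * r ^ 2 / R ^ 2) {m : ℕ} (hm : R * ρ ≤ m * τ) {K : ℕ}
    (hK : ∀ y, ∀ S ⊆ F, (∀ x ∈ S, ‖x - y‖ ≤ r) → S.card ≤ K) :
    F.card * ρ ^ n ≤ (2 * m + 1) * K * s ^ n := by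
  classical
  set μ : Measure (EuclideanSpace ℝ (Fin n)) := volume
  have h1 : (F.card : ENNReal) * μ (closedBall 0 ρ) ≤
      (2 * m + 1 : ℕ) * (K * μ (closedBall 0 s)) := by
    rw [← nsmul_eq_mul]
    refine (Finset.card_nsmul_le_sum F _ _ fun x hx => measure_closedBall_le_mul_lens μ hR hr hs
      hrs (hF x hx) hρ hτ hρτ hm).trans ?_
    rw [← Finset.mul_sum]
    gcongr
    exact sum_measure_closedBall_inter_le μ F hK
  have hb0 : μ (closedBall 0 1) ≠ 0 := (measure_closedBall_pos μ _ one_pos).ne'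
  have hb1 : μ (closedBall 0 1) ≠ ⊤ := measure_closedBall_lt_top.ne
  rw [Measure.addHaar_closedBall' μ 0 hρ, Measure.addHaar_closedBall' μ 0 hs,
    finrank_euclideanSpace_fin, ← mul_assoc, ← mul_assoc, ← mul_assoc,
    ENNReal.mul_le_mul_iff_left hb0 hb1] at h1
  have h2 := ENNReal.toReal_mono (by finiteness) h1
  simp only [ENNReal.toReal_mul, ENNReal.toReal_natCast, ENNReal.toReal_ofReal (pow_nonneg hρ n),
    ENNReal.toReal_ofReal (pow_nonneg hs n)] at h2
  exact_mod_cast h2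

/-! ### Rates and asymptotics -/

/-- A uniform bound on finite subcodes also rules out infinite codes, whose rate would be `⊤`. -/
theorem rate_le_of_forall_finset {n : ℕ} (hn : 0 < n) {C : Set (EuclideanSpace ℝ (Fin n))} {z : ℝ}
    (h : ∀ F : Finset (EuclideanSpace ℝ (Fin n)), (F : Set _) ⊆ C →
      (F.card : ℝ) ≤ Real.exp (z * n)) : rate C ≤ (z : EReal) := by
  have hn' : (0 : EReal) < n := by exact_mod_cast hn
  have hfin : C.Finite := by
    by_contra hinf
    obtain ⟨k, hk⟩ := exists_nat_gt (Real.exp (z * n))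
    obtain ⟨F, hFC, hF⟩ := Set.Infinite.exists_subset_card_eq hinf k
    have := h F hFC
    rw [hF] at this
    linarith
  unfold rate
  rw [EReal.div_le_iff_le_mul hn' (EReal.natCast_ne_top n)]
  have h1 : (C.encard : ENNReal) ≤ ENNReal.ofReal (Real.exp (z * n)) := by
    rw [hfin.encard_eq_coe_toFinset_card, ENat.toENNReal_coe]
    refine ENNReal.le_ofReal_iff_toReal_le (ENNReal.natCast_ne_top _) (Real.exp_pos _).le |>.mpr ?_
    simpa using h hfin.toFinset (by simp)
  refine (ENNReal.log_le_log h1).trans (le_of_eq ?_)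
  rw [ENNReal.log_ofReal_of_pos (Real.exp_pos _), Real.log_exp]
  push_cast
  rw [mul_comm]

/-- Codes of rate exceeding the bound by a constant are not list-decodable in high dimension. -/
theorem eventually_card_le {L : ℕ} (hL : 2 ≤ L) {N P : ℝ} (hN : 0 < N) (hP : 0 < P)
    (hNP : N / P ≤ ((L : ℝ) - 1) / L) {ε : ℝ} (hε : 0 < ε) :
    ∀ᶠ n : ℕ in atTop, ∀ C : Set (EuclideanSpace ℝ (Fin n)), IsListDecodable L P N C →
      ∀ F : Finset (EuclideanSpace ℝ (Fin n)), (F : Set _) ⊆ C → (F.card : ℝ) ≤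
        Real.exp ((1 / 2 * Real.log (((L : ℝ) - 1) * P / (L * N)) + 2 * ε) * n) := by
  have hL' : (2 : ℝ) ≤ L := by exact_mod_cast hL
  have hL1 : (0 : ℝ) < L - 1 := by linarith
  have hL0 : (0 : ℝ) < L := by linarith
  set T : ℝ := L * N / (L - 1) with hT
  have hT0 : 0 < T := by positivity
  have hTP : T ≤ P := by
    rw [div_le_div_iff₀ hP hL0] at hNP
    rw [hT, div_le_iff₀ hL1]
    linarith
  have hratio : ((L : ℝ) - 1) * P / (L * N) = P / T := by
    rw [hT]; field_simp
  rw [hratio]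
  set u : ℝ := Real.exp (-ε) with hu
  have hu0 : 0 < u := Real.exp_pos _
  have hu1 : u < 1 := by rw [hu, Real.exp_lt_one_iff]; linarith
  set Q : ℝ := T * u with hQ
  have hQ0 : 0 < Q := by positivity
  have hQT : Q < T := mul_lt_of_lt_one_right hT0 hu1
  have hPQ : 0 < P - Q := by linarith
  -- nH is the lens budget s²r²/R². The share u goes to ρ² and 1-u to 2τ; both scale with n, so `m`
  -- can be chosen independent of n.
  set H : ℝ := Q * (P - Q) / P with hH
  have hH0 : 0 < H := by positivity
  have hQN : ((L : ℝ) - 1) / L * Q < N := by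
    calc ((L : ℝ) - 1) / L * Q < ((L : ℝ) - 1) / L * T := by gcongr
      _ = N := by rw [hT]; field_simp
  obtain ⟨K, hK⟩ := exists_card_le_of_subset_closedBall hL hQ0 hQN
  obtain ⟨m, hm⟩ := exists_nat_ge (√P * √(u * H) / ((1 - u) * H / 2))
  have h1u : 0 < (1 - u) * H / 2 := by
    have : 0 < 1 - u := by linarith
    positivity
  rw [div_le_iff₀ h1u] at hm
  have hlarge : ∀ᶠ n : ℕ in atTop, ((2 * m + 1) * K : ℝ) ≤ Real.exp (ε * n) :=
    (Real.tendsto_exp_atTop.comp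
      (tendsto_natCast_atTop_atTop.const_mul_atTop hε)).eventually_ge_atTop _
  filter_upwards [hlarge, eventually_gt_atTop 0] with n hnD hn C hC F hFC
  have hn' : (0 : ℝ) < n := by exact_mod_cast hn
  rw [isListDecodable_iff hn hL hN] at hC
  obtain ⟨hCP, hCN⟩ := hC
  have hlist : ∀ S ⊆ F, S.card = L → ∀ y, ∃ x ∈ S, n * N < ‖x - y‖ ^ 2 := by
    intro S hSF hSL y
    by_contra! hall
    have h1 : (S : Set (EuclideanSpace ℝ (Fin n))) ⊆ C ∩ closedBall y (√(n * N)) := by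
      intro x hx
      refine ⟨hFC (hSF hx), ?_⟩
      rw [mem_closedBall, dist_eq_norm]
      exact Real.le_sqrt_of_sq_le (hall x hx)
    have h2 := (Set.encard_le_encard h1).trans (hCN y)
    rw [Set.encard_coe_eq_coe_finsetCard, hSL] at h2
    have : L ≤ L - 1 := by exact_mod_cast h2
    omega
  have hcount := card_mul_pow_le F (R := √(n * P)) (r := √(n * Q)) (s := √(n * (P - Q)))
    (ρ := √(n * (u * H))) (τ := n * ((1 - u) * H / 2)) (m := m) (K := K) (by positivity)
    (by positivity) (by positivity)
    (by
      rw [Real.sq_sqrt (by positivity), Real.sq_sqrt (by positivity), Real.sq_sqrt (by positivity)]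
      ring)
    (fun x hx => by simpa using hCP (hFC hx)) (by positivity) (by positivity)
    (by
      rw [Real.sq_sqrt (by positivity), Real.sq_sqrt (by positivity), Real.sq_sqrt (by positivity),
        Real.sq_sqrt (by positivity), hH]
      refine le_of_eq ?_
      field_simp
      ring)
    (by
      rw [Real.sqrt_mul hn'.le, Real.sqrt_mul hn'.le]
      calc √n * √P * (√n * √(u * H)) = (√n * √n) * (√P * √(u * H)) := by ring
        _ = n * (√P * √(u * H)) := by rw [Real.mul_self_sqrt hn'.le]
        _ ≤ n * (m * ((1 - u) * H / 2)) := by gcongr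
        _ = m * (n * ((1 - u) * H / 2)) := by ring)
    (fun y S hSF hS => hK n hn S y
      (fun x hx => by
        have := hS x hx
        rwa [Real.le_sqrt (norm_nonneg _) (by positivity)] at this)
      fun S' hS' => hlist S' (hS'.trans hSF))
  -- (P-Q)/(uH) = P/(T u²), so the two factors `u` cost ε in the rate; the constant (2m+1)K costs
  -- the other ε.
  have hexp : √(n * (P - Q)) =
      Real.exp (1 / 2 * Real.log (P / T) + ε) * √(n * (u * H)) := by
    rw [Real.sqrt_eq_iff_mul_self_eq (by positivity) (by positivity), mul_mul_mul_comm,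
      Real.mul_self_sqrt (by positivity), ← Real.exp_add]
    have e : 1 / 2 * Real.log (P / T) + ε + (1 / 2 * Real.log (P / T) + ε) =
      Real.log (P / T) - (-ε) - (-ε) := by ring
    rw [e, Real.exp_sub, Real.exp_sub, Real.exp_log (by positivity), ← hu, hH, hQ]
    field_simp
  rw [hexp, mul_pow, ← mul_assoc _ (Real.exp _ ^ n), ← Real.exp_nat_mul] at hcount
  have h2 := le_of_mul_le_mul_right hcount (by positivity)
  refine h2.trans ((mul_le_mul_of_nonneg_right hnD (Real.exp_pos _).le).trans (le_of_eq ?_))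
  rw [← Real.exp_add]
  congr 1
  ring

end MultiplePacking

theorem mainTheorem2 (L : ℕ) (hL : 2 ≤ L) (N P : ℝ) (hN : 0 < N) (hP : 0 < P)
    (hNP : N / P ≤ ((L : ℝ) - 1) / L) :
    MultiplePacking.capacity L P N ≤
      ((1 / 2 * Real.log (((L : ℝ) - 1) * P / (L * N)) : ℝ) : EReal) := by
  refine EReal.le_of_forall_lt_iff_le.mp fun z hz => ?_
  rw [EReal.coe_lt_coe_iff] at hz
  set v : ℝ := 1 / 2 * Real.log (((L : ℝ) - 1) * P / (L * N)) with hv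
  have hε : 0 < (z - v) / 2 := by linarith
  refine Filter.limsup_le_of_le (by isBoundedDefault) ?_
  filter_upwards [MultiplePacking.eventually_card_le hL hN hP hNP hε,
    Filter.eventually_gt_atTop 0] with n hcard hn
  refine iSup₂_le fun C hC => MultiplePacking.rate_le_of_forall_finset hn fun F hF => ?_
  have h := hcard C hC F hF
  rwa [← hv, mul_div_cancel₀ _ two_ne_zero, add_sub_cancel] at h
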